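/- **Definitions.** Let $\Omega$ be a locally compact Hausdorff space, let $\mathbb{K}$ be $\mathbb{R}$ or $\mathbb{C}$, and let $\mathcal{C}(\Omega)$ and $\mathcal{C}_0(\Omega)$ be the algebras of continuous $\mathbb{K}$-valued functions on $\Omega$ and of those vanishing at infinity. Let $\mathbf{Z}(f)=\{x\in\Omega: f(x)=0\}$ and $\mathbf{Z}[\Omega]=\{\mathbf{Z}(f): f\in\mathcal{C}(\Omega)\}$. Let $\Omega\cup\{\infty\}$ be the one-point compactification of $\Omega$ (with $\infty$ isolated if $\Omega$ is compact). For a compact space $X$, let $X^{(1)}$ be the set of limit points of $X$, let $X^{(n+1)}$ be the set of limit points of the subspace $X^{(n)}$ $(n\ge 1)$, and let $X^{(\infty)}=\bigcap_{n\ge 1}X^{(n)}$. A *$z$-filter* on $\Omega$ is a non-empty proper subset of $\mathbf{Z}[\Omega]$ that is closed under finite intersections and under supersets in $\mathbf{Z}[\Omega]$. A $z$-filter $\mathcal{P}$ is *prime* if $Z_1\cup Z_2\notin\mathcal{P}$ whenever $Z_1,Z_2\in\mathbf{Z}[\Omega]\setminus\mathcal{P}$. A prime $z$-filter $\mathcal{P}$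 is *supported at* $p\in\Omega$ if $p\in Z$ for every $Z\in\mathcal{P}$, and *supported at* $\infty$ if no point of $\Omega$ belongs to every $Z\in\mathcal{P}$. Put $\mathbf{Z}^{-1}[\mathcal{P}]=\{f\in\mathcal{C}(\Omega):\mathbf{Z}(f)\in\mathcal{P}\}$. A *prime ideal* of $\mathcal{C}_0(\Omega)$ is a proper ideal $P$ such that $fg\in P$ implies $f\in P$ or $g\in P$. An ideal $I$ of $\mathcal{C}_0(\Omega)$ is a *$z$-ideal* if $g\in I$ whenever $f\in I$, $g\in\mathcal{C}_0(\Omega)$ and $\mathbf{Z}(f)\subset\mathbf{Z}(g)$. A prime ideal $P$ is *supported at* $p\in\Omega$ if $p$ is the unique common zero in $\Omega$ of the functions in $P$, and *supported at* $\infty$ if these functions have no common zero in $\Omega$. A family $(A_i: i\in S)$ of prime $z$-filters, or of prime ideals, is *pseudo-finite* if every element of $\bigcup_{i\in S}A_i$ belongs to $A_i$ for all but finitely many $i\in S$. It is *non-redundant* if $\bigcap_{i\in T}A_i\ne\bigcap_{i\in S}A_i$ for every proper subset $T$ of $S$. **Theorem.** Let $\Omega$ be a locally compact metrizable space, and let $p\in(\Omega\cup\{\infty\})^{(\infty)}$.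 Let $\mathfrak{c}=2^{\aleph_0}$. Then there exists a non-redundant pseudo-finite family $(\mathcal{P}_\alpha:\alpha<\mathfrak{c})$ of prime $z$-filters on $\Omega$, each supported at $p$, such that the sets $$P_\alpha=\mathcal{C}_0(\Omega)\cap\mathbf{Z}^{-1}[\mathcal{P}_\alpha]\qquad(\alpha<\mathfrak{c})$$ form a non-redundant pseudo-finite family of prime $z$-ideals of $\mathcal{C}_0(\Omega)$, each supported at $p$, and $$\Bigl|\,\mathcal{C}_0(\Omega)\big/\bigcap_{\alpha<\mathfrak{c}}P_\alpha\Bigr|=\mathfrak{c}.$$ -/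

import Mathlib

open Set Filter Topology
open scoped ZeroAtInfty OnePoint

namespace PrimeZ

/-- The `n`-th Cantor-Bendixson level of a space `X`: level `0` is `X`, and level `n + 1` is the
set of limit points of level `n` (regarded as a subspace). -/
def cbLevel (X : Type*) [TopologicalSpace X] (n : ℕ) : Set X :=
  CantorBendixson.iteratedDerivedSet (univ : Set X) (n : Ordinal)

theorem cbLevel_zero (X : Type*) [TopologicalSpace X] : cbLevel X 0 = univ := by
  simp [cbLevel]

theorem cbLevel_succ (X : Type*) [TopologicalSpace X] (n : ℕ) :
    cbLevel X (n + 1) = relDerivedSet (cbLevel X n) := by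
  simp [cbLevel]

/-- The intersection of all the finite Cantor-Bendixson levels. -/
def cbLevelInfty (X : Type*) [TopologicalSpace X] : Set X :=
  ⋂ n : ℕ, cbLevel X n

/-- A family of sets is pseudo-finite if each element of the union belongs to all but finitely
many members of the family. -/
def PseudoFinite {ι X : Type*} (P : ι → Set X) : Prop :=
  ∀ x ∈ ⋃ i, P i, {i | x ∉ P i}.Finite

/-- A family of sets is non-redundant if no proper subfamily has the same intersection. -/
def NonRedundant {ι X : Type*} (P : ι → Set X) : Prop :=
  ∀ T : Set ι, T ≠ univ → ⋂ i ∈ T, P i ≠ ⋂ i, P i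

section

variable (𝕜 : Type*) [RCLike 𝕜] (Ω : Type*) [TopologicalSpace Ω]

/-- The family of all zero sets of continuous `𝕜`-valued functions on `Ω`. -/
def zeroSets : Set (Set Ω) :=
  {Z | ∃ f : C(Ω, 𝕜), Z = {x | f x = 0}}

/-- A `z`-filter on `Ω`: a non-empty proper subfamily of the family of zero sets, closed under
finite intersections and under zero sets that are supersets. -/
structure ZFilter where
  /-- The members of the `z`-filter. -/
  sets : Set (Set Ω)
  subset_zeroSets : sets ⊆ zeroSets 𝕜 Ω
  nonempty : sets.Nonempty
  proper : sets ≠ zeroSets 𝕜 Ω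
  inter_mem : ∀ Z₁ ∈ sets, ∀ Z₂ ∈ sets, Z₁ ∩ Z₂ ∈ sets
  mem_of_superset : ∀ Z₁ ∈ sets, ∀ Z₂ ∈ zeroSets 𝕜 Ω, Z₁ ⊆ Z₂ → Z₂ ∈ sets

end

section

variable {𝕜 : Type*} [RCLike 𝕜] {Ω : Type*} [TopologicalSpace Ω]

theorem zeroSet_mem (f : C₀(Ω, 𝕜)) : {x | f x = 0} ∈ zeroSets 𝕜 Ω :=
  ⟨f.toContinuousMap, rfl⟩

/-- A `z`-filter is prime if the union of two zero sets outside it is again outside it. -/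
def ZFilter.IsPrime (F : ZFilter 𝕜 Ω) : Prop :=
  ∀ Z₁ ∈ zeroSets 𝕜 Ω, ∀ Z₂ ∈ zeroSets 𝕜 Ω,
    Z₁ ∉ F.sets → Z₂ ∉ F.sets → Z₁ ∪ Z₂ ∉ F.sets

/-- The `z`-filter `F` is supported at the point `p` of the one-point compactification: if `p` is
a point of `Ω`, then `p` belongs to all members of `F`; if `p` is the point at infinity, then no
point of `Ω` belongs to all members of `F`. -/
def ZFilter.SupportedAt (F : ZFilter 𝕜 Ω) : OnePoint Ω → Prop
  | ∞ => ¬ ∃ q : Ω, ∀ Z ∈ F.sets, q ∈ Z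
  | (p : Ω) => ∀ Z ∈ F.sets, p ∈ Z

/-- The functions in `C₀(Ω, 𝕜)` whose zero set belongs to the `z`-filter `F`. -/
def ZFilter.c0Ideal (F : ZFilter 𝕜 Ω) : Submodule 𝕜 C₀(Ω, 𝕜) where
  carrier := {f | {x | f x = 0} ∈ F.sets}
  zero_mem' := by
    obtain ⟨Z, hZ⟩ := F.nonempty
    exact F.mem_of_superset Z hZ _ (zeroSet_mem 0) (fun x _ => by simp)
  add_mem' := by
    intro f g hf hg
    refine F.mem_of_superset _ (F.inter_mem _ hf _ hg) _ (zeroSet_mem (f + g)) ?_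
    rintro x ⟨h₁, h₂⟩
    have h₁ : f x = 0 := h₁
    have h₂ : g x = 0 := h₂
    simp [h₁, h₂]
  smul_mem' := by
    intro c f hf
    refine F.mem_of_superset _ hf _ (zeroSet_mem (c • f)) ?_
    intro x h
    have h : f x = 0 := h
    simp [h]

/-- A linear subspace of the commutative algebra `C₀(Ω, 𝕜)` is an ideal. -/
def IsIdeal (I : Submodule 𝕜 C₀(Ω, 𝕜)) : Prop :=
  ∀ f : C₀(Ω, 𝕜), ∀ g ∈ I, f * g ∈ I

/-- Prime ideals of `C₀(Ω, 𝕜)`; they are proper. -/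
def IsPrimeIdeal (I : Submodule 𝕜 C₀(Ω, 𝕜)) : Prop :=
  IsIdeal I ∧ I ≠ ⊤ ∧ ∀ f g : C₀(Ω, 𝕜), f * g ∈ I → f ∈ I ∨ g ∈ I

/-- `z`-ideals of `C₀(Ω, 𝕜)`: membership depends on the zero set only, monotonically. -/
def IsZIdeal (I : Submodule 𝕜 C₀(Ω, 𝕜)) : Prop :=
  IsIdeal I ∧ ∀ f ∈ I, ∀ g : C₀(Ω, 𝕜), {x | f x = 0} ⊆ {x | g x = 0} → g ∈ I

/-- The ideal `I` is supported at the point `p` of the one-point compactification: if `p` is a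
point of `Ω`, then `p` is the unique common zero of the functions in `I`; if `p` is the point at
infinity, then the functions in `I` have no common zero. -/
def IdealSupportedAt (I : Submodule 𝕜 C₀(Ω, 𝕜)) : OnePoint Ω → Prop
  | ∞ => ¬ ∃ q : Ω, ∀ f ∈ I, f q = 0
  | (p : Ω) => ∀ q : Ω, (∀ f ∈ I, f q = 0) ↔ q = p

end

end PrimeZ

namespace PrimeZ

/-! An ultrafilter on `Ω` induces a prime z-filter, so it suffices to find ultrafilters `u α`
converging to `p` whose closed members behave pseudo-finitely. Suppose given open sets `G α` and
decreasing sets `T m`, all `T m` meeting every neighbourhood of `p` outside any finitely many `G β`.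
Choose an ultrafilter `v` converging to `p`, containing every `T m` and every `(G α)ᶜ`, with a
minimal family of closed members. To get `u α`, keep the open members of `v` but replace `(G α)ᶜ` by
`G α`. Closed members of `u α` are members of `v`; by minimality each contains the intersection of
an open member of `v` with a set that involves only finitely many `(G β)ᶜ`, so it lies in all but
finitely many `u β` (`exists_pseudoFinite_ultrafilters`).

The replacement is consistent if points of `T M` avoiding finitely many `G β` are limits of points
of `T m` that avoid them too and lie in another given `G α`. Each passage to such a limit costs one
unit of Cantor-Bendixson rank, hence the hypothesis on `p`. Near points of larger and larger finite
rank, `exists_labelledRank` supplies open sets with countably many labels; eventually different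
sequences of labels turn these into `𝔠` many sets `G α`.

Since `T 0` is countable, some function in `C₀(Ω, 𝕜)` vanishes nowhere on it, which makes the ideals
proper and non-redundant; and functions vanishing on `T 0` lie in every ideal, which bounds the
quotient. -/

/-! ### Ultrafilters with few closed members -/

/-- Below every proper filter `B` there is an ultrafilter `u` with the property that the trace of
`u` on closed sets is minimal among the prime filters of closed sets containing that of `B`. -/
theorem exists_ultrafilter_le_forall_isClosed {X : Type*} [TopologicalSpace X] (B : Filter X)
    [B.NeBot] :
    ∃ u : Ultrafilter X, ↑u ≤ B ∧ ∀ Z ∈ u, IsClosed Z →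
      ∃ V ∈ u, IsOpen V ∧ ∃ b ∈ B, V ∩ b ⊆ Z := by
  -- Families of open sets with the finite intersection property relative to `B`; a maximal one
  -- exists by Tukey's lemma.
  let C : Set (Set (Set X)) := {S | (∀ V ∈ S, IsOpen V) ∧
    ∀ t ⊆ S, t.Finite → ∀ b ∈ B, (⋂₀ t ∩ b).Nonempty}
  have hC : Order.IsOfFiniteCharacter C := by
    intro S
    constructor
    · intro hS t htS _
      exact ⟨fun V hV => hS.1 V (htS hV), fun t' ht' => hS.2 t' (ht'.trans htS)⟩
    · intro h
      refine ⟨fun V hV => (h {V} (by simpa using hV) (finite_singleton V)).1 V rfl, ?_⟩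
      intro t ht hf
      exact (h t ht hf).2 t subset_rfl hf
  have h0 : ∅ ∈ C := by
    refine ⟨by simp, fun t ht _ b hb => ?_⟩
    obtain rfl := subset_empty_iff.1 ht
    simpa using Filter.nonempty_of_mem hb
  obtain ⟨S, -, hS, hmax⟩ := hC.exists_maximal h0
  let W : Filter X :=
    { sets := {s | ∃ t ⊆ S, t.Finite ∧ ∃ b ∈ B, ⋂₀ t ∩ b ⊆ s}
      univ_sets := ⟨∅, by simp, by simp, univ, univ_mem, by simp⟩
      sets_of_superset := by
        rintro x y ⟨t, h1, h2, b, hb, h⟩ hxy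
        exact ⟨t, h1, h2, b, hb, h.trans hxy⟩
      inter_sets := by
        rintro x y ⟨t, h1, h2, b, hb, h⟩ ⟨t', h1', h2', b', hb', h'⟩
        refine ⟨t ∪ t', union_subset h1 h1', h2.union h2', b ∩ b', inter_mem hb hb', ?_⟩
        rw [sInter_union]
        exact fun z hz => ⟨h ⟨hz.1.1, hz.2.1⟩, h' ⟨hz.1.2, hz.2.2⟩⟩ }
  have hW : W.NeBot := by
    refine ⟨fun h => ?_⟩
    obtain ⟨t, h1, h2, b, hb, h⟩ : ∅ ∈ W := by rw [h]; trivial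
    obtain ⟨z, hz⟩ := hS.2 t h1 h2 b hb
    exact h hz
  have hu := Ultrafilter.of_le W
  have hSu : ∀ t ⊆ S, t.Finite → ⋂₀ t ∈ Ultrafilter.of W := fun t ht hf =>
    hu ⟨t, ht, hf, univ, univ_mem, inter_subset_left⟩
  refine ⟨Ultrafilter.of W, fun b hb => hu ⟨∅, by simp, by simp, b, hb, by simp⟩, ?_⟩
  intro Z hZ hZc
  -- If `Zᶜ` could be added, maximality would put it in the ultrafilter together with `Z`. Otherwise
  -- a finite obstruction exists, and deleting `Zᶜ` from it leaves the required `V`.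
  by_cases hins : insert Zᶜ S ∈ C
  · have : Zᶜ ∈ S := hmax hins (subset_insert _ _) (mem_insert _ _)
    have h2 := hSu {Zᶜ} (by simpa using this) (finite_singleton _)
    rw [sInter_singleton, Ultrafilter.compl_mem_iff_notMem] at h2
    exact absurd hZ h2
  · have : ∃ t ⊆ insert Zᶜ S, t.Finite ∧ ∃ b ∈ B, ¬ (⋂₀ t ∩ b).Nonempty := by
      by_contra! hcon
      refine hins ⟨?_, fun t h1 h2 b hb => hcon t h1 h2 b hb⟩
      rintro V (rfl | hV)
      exacts [hZc.isOpen_compl, hS.1 V hV]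
    obtain ⟨t, h1, h2, b, hb, h⟩ := this
    have hs : t \ {Zᶜ} ⊆ S := by
      rintro V ⟨hV, hV'⟩
      exact (h1 hV).resolve_left hV'
    refine ⟨⋂₀ (t \ {Zᶜ}), hSu _ hs (h2.subset sdiff_subset),
      (h2.subset sdiff_subset).isOpen_sInter fun V hV => hS.1 V (hs hV), b, hb, ?_⟩
    rintro z ⟨hz, hzb⟩
    by_contra hzZ
    refine h ⟨z, fun V hV => ?_, hzb⟩
    by_cases hVZ : V = Zᶜ
    · rw [hVZ]; exact hzZ
    · exact hz V ⟨hV, hVZ⟩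

/-- The filter generated by a filter `N`, a decreasing sequence of sets `T m`, and the complements
of the sets `G α` for `α` in `A`. -/
def avoidFilter {X ι : Type*} (N : Filter X) (T : ℕ → Set X) (hT : Antitone T) (G : ι → Set X)
    (A : Set ι) : Filter X where
  sets := {W | ∃ F : Finset ι, ↑F ⊆ A ∧ ∃ m, ∃ s ∈ N, s ∩ (T m \ ⋃ β ∈ F, G β) ⊆ W}
  univ_sets := ⟨∅, by simp, 0, univ, univ_mem, subset_univ _⟩
  sets_of_superset := by
    rintro x y ⟨F, hF, m, s, hs, h⟩ hxy
    exact ⟨F, hF, m, s, hs, h.trans hxy⟩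
  inter_sets := by
    classical
    rintro x y ⟨F, hF, m, s, hs, h⟩ ⟨F', hF', m', s', hs', h'⟩
    refine ⟨F ∪ F', by simp [hF, hF'], max m m', s ∩ s', inter_mem hs hs', ?_⟩
    rintro z ⟨hz, hzT, hzG⟩
    simp only [Finset.mem_union, mem_iUnion, not_exists] at hzG
    refine ⟨h ⟨hz.1, hT (le_max_left _ _) hzT, ?_⟩, h' ⟨hz.2, hT (le_max_right _ _) hzT, ?_⟩⟩
    · simpa using fun β hβ => hzG β (Or.inl hβ)
    · simpa using fun β hβ => hzG β (Or.inr hβ)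

theorem avoidFilter_le {X ι : Type*} (N : Filter X) (T : ℕ → Set X) (hT : Antitone T)
    (G : ι → Set X) (A : Set ι) : avoidFilter N T hT G A ≤ N :=
  fun s hs => ⟨∅, by simp, 0, s, hs, inter_subset_left⟩

/-- The ultrafilters whose traces on closed sets form a pseudo-finite non-redundant family. -/
theorem exists_pseudoFinite_ultrafilters {X ι : Type*} [TopologicalSpace X] (N : Filter X)
    (hN : ∀ s ∈ N, ∃ U ∈ N, IsOpen U ∧ U ⊆ s) (T : ℕ → Set X) (hT : Antitone T) (G : ι → Set X)
    (hne : ∀ (F : Finset ι) (m : ℕ), ∀ s ∈ N, (s ∩ (T m \ ⋃ β ∈ F, G β)).Nonempty)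
    (hcl : ∀ (F : Finset ι) (α : ι) (m : ℕ), α ∉ F → ∃ M,
      T M \ ⋃ β ∈ F, G β ⊆ closure ((T m \ ⋃ β ∈ F, G β) ∩ G α)) :
    ∃ u : ι → Ultrafilter X, (∀ α, ↑(u α) ≤ N) ∧ (∀ α m, T m ∈ u α) ∧ (∀ α, G α ∈ u α) ∧
      (∀ α β, α ≠ β → G α ∉ u β) ∧
      ∀ Z, IsClosed Z → ∀ α, Z ∈ u α → {β | Z ∉ u β}.Finite := by
  have hB : (avoidFilter N T hT G univ).NeBot := by
    refine ⟨fun h => ?_⟩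
    obtain ⟨F, -, m, s, hs, h⟩ : ∅ ∈ avoidFilter N T hT G univ := by rw [h]; trivial
    obtain ⟨z, hz⟩ := hne F m s hs
    exact h hz
  obtain ⟨v, hv, hvmin⟩ := exists_ultrafilter_le_forall_isClosed (avoidFilter N T hT G univ)
  let H : ι → Filter X := fun α =>
    { sets := {W | ∃ V ∈ v, IsOpen V ∧ ∃ b ∈ avoidFilter N T hT G {α}ᶜ, V ∩ b ∩ G α ⊆ W}
      univ_sets := ⟨univ, univ_mem, isOpen_univ, univ, univ_mem, subset_univ _⟩
      sets_of_superset := by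
        rintro x y ⟨V, h1, h2, b, hb, h⟩ hxy
        exact ⟨V, h1, h2, b, hb, h.trans hxy⟩
      inter_sets := by
        rintro x y ⟨V, h1, h2, b, hb, h⟩ ⟨V', h1', h2', b', hb', h'⟩
        refine ⟨V ∩ V', inter_mem h1 h1', h2.inter h2', b ∩ b', inter_mem hb hb', ?_⟩
        exact fun z hz => ⟨h ⟨⟨hz.1.1.1, hz.1.2.1⟩, hz.2⟩, h' ⟨⟨hz.1.1.2, hz.1.2.2⟩, hz.2⟩⟩ }
  have hH : ∀ α, (H α).NeBot := by
    intro α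
    refine ⟨fun h => ?_⟩
    obtain ⟨V, hV, hVo, b, ⟨F, hF, m, s, hs, hb⟩, h⟩ : ∅ ∈ H α := by rw [h]; trivial
    have hαF : α ∉ F := fun h => hF h rfl
    -- `s` is shrunk to an open set because the point found below is moved to a nearby point of `G
    -- α`.
    obtain ⟨U, hU, hUo, hUs⟩ := hN s hs
    obtain ⟨M, hM⟩ := hcl F α m hαF
    have h1 : U ∩ (T M \ ⋃ β ∈ F, G β) ∈ v := hv ⟨F, subset_univ _, M, U, hU, subset_rfl⟩
    obtain ⟨z, hzV, hzU, hz⟩ := v.nonempty_of_mem (inter_mem hV h1)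
    obtain ⟨y, ⟨hyV, hyU⟩, hy, hyG⟩ :=
      mem_closure_iff.1 (hM hz) (V ∩ U) (hVo.inter hUo) ⟨hzV, hzU⟩
    exact h ⟨⟨hyV, hb ⟨hUs hyU, hy⟩⟩, hyG⟩
  have hu := fun α => Ultrafilter.of_le (H α)
  have huB : ∀ α, ↑(Ultrafilter.of (H α)) ≤ avoidFilter N T hT G {α}ᶜ := fun α b hb =>
    hu α ⟨univ, univ_mem, isOpen_univ, b, hb, fun z hz => hz.1.2⟩
  have huv : ∀ α, ∀ V ∈ v, IsOpen V → V ∈ Ultrafilter.of (H α) := fun α V hV hVo =>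
    hu α ⟨V, hV, hVo, univ, univ_mem, fun z hz => hz.1.1⟩
  refine ⟨fun α => Ultrafilter.of (H α), fun α => (huB α).trans (avoidFilter_le ..), ?_, ?_, ?_, ?_⟩
  · exact fun α m => huB α ⟨∅, by simp, m, univ, univ_mem, fun z hz => hz.2.1⟩
  · exact fun α => hu α ⟨univ, univ_mem, isOpen_univ, univ, univ_mem, inter_subset_right⟩
  · intro α β hαβ
    rw [← Ultrafilter.compl_mem_iff_notMem]
    refine huB β ⟨{α}, by simpa using hαβ.symm, 0, univ, univ_mem, ?_⟩
    rintro z ⟨-, -, hz⟩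
    simpa using hz
  · intro Z hZ α hZα
    have hZv : Z ∈ v := by
      by_contra hcon
      rw [← Ultrafilter.compl_mem_iff_notMem] at hcon
      have := huv α _ hcon hZ.isOpen_compl
      rw [Ultrafilter.compl_mem_iff_notMem] at this
      exact this hZα
    obtain ⟨V, hV, hVo, b, ⟨F, -, m, s, hs, hb⟩, hVb⟩ := hvmin Z hZv hZ
    -- For `β` outside `F`, the set `b` is also available in the filter that omits only the
    -- condition at `β`.
    refine F.finite_toSet.subset fun β hβ => ?_
    by_contra hβF
    refine hβ (mem_of_superset (inter_mem (huv β V hV hVo) (huB β ⟨F, ?_, m, s, hs, hb⟩)) hVb)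
    exact fun γ hγ h => hβF (h ▸ hγ)

/-! ### Cantor-Bendixson rank with labels -/

/-- A sequence converging to a point outside its range has a subsequence whose terms have pairwise
disjoint open neighbourhoods. -/
theorem exists_subseq_disjoint_open {X : Type*} [TopologicalSpace X] [T2Space X] {p : X}
    {x : ℕ → X} (hx : Tendsto x atTop (𝓝 p)) (hne : ∀ n, x n ≠ p) :
    ∃ φ : ℕ → ℕ, StrictMono φ ∧ ∃ U : ℕ → Set X, (∀ n, IsOpen (U n)) ∧ (∀ n, x (φ n) ∈ U n) ∧
      (∀ n, p ∉ U n) ∧ Pairwise fun m n => Disjoint (U m) (U n) := by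
  choose A B hA hB hxA hpB hAB using fun n => t2_separation (hne n)
  have hev : ∀ m, ∃ N, m < N ∧ ∀ n ≥ N, x n ∈ B m := fun m => by
    obtain ⟨N, hN⟩ := eventually_atTop.1 (hx.eventually_mem ((hB m).mem_nhds (hpB m)))
    exact ⟨max N (m + 1), by lia, fun n hn => hN n (by lia)⟩
  choose g hg hgB using hev
  let φ : ℕ → ℕ := fun n => g^[n] 0
  have hφs : ∀ n, φ (n + 1) = g (φ n) := fun n => Function.iterate_succ_apply' g n 0
  have hφ : StrictMono φ := strictMono_nat_of_lt_succ fun n => by rw [hφs]; exact hg _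
  have hlt : ∀ i j, i < j → x (φ j) ∈ B (φ i) := fun i j hij =>
    hgB _ _ (by rw [← hφs]; exact hφ.monotone hij)
  -- The index `φ j` is so late that `x (φ j)` lies in every earlier `B (φ i)`, which is disjoint
  -- from `A (φ i)`.
  refine ⟨φ, hφ, fun n => A (φ n) ∩ ⋂ i ∈ Iio n, B (φ i), fun n => ?_, fun n => ?_, fun n => ?_, ?_⟩
  · exact (hA _).inter ((finite_Iio n).isOpen_biInter fun i _ => hB _)
  · exact ⟨hxA _, mem_iInter₂.2 fun i hi => hlt i n hi⟩
  · exact fun h => disjoint_left.1 (hAB _) h.1 (hpB _)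
  · have key : ∀ m n, m < n → Disjoint (A (φ m) ∩ ⋂ i ∈ Iio m, B (φ i))
        (A (φ n) ∩ ⋂ i ∈ Iio n, B (φ i)) := fun m n hmn =>
      disjoint_left.2 fun z hz hz' => disjoint_left.1 (hAB _) hz.1 (mem_iInter₂.1 hz'.2 m hmn)
    intro m n hmn
    rcases hmn.lt_or_gt with h | h
    exacts [key m n h, (key n m h).symm]

/-- A decreasing sequence `T` of sets, where `T m` is thought of as the points of rank at least `m`,
together with open sets `G i` such that every point `y` of `T (m + 1)` is, for every label `i`, a
limit of points of `T m` that lie in `G i` and in no other `G j` except those containing `y`. -/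
structure LabelledRank {X : Type*} [TopologicalSpace X] (T G : ℕ → Set X) : Prop where
  antitone : Antitone T
  countable : (T 0).Countable
  isOpen : ∀ i, IsOpen (G i)
  mem_closure : ∀ m i, ∀ y ∈ T (m + 1),
    y ∈ closure {z | z ∈ T m ∧ z ∈ G i ∧ ∀ j ≠ i, z ∈ G j → y ∈ G j}

/-- Near a point of finite Cantor-Bendixson rank at least `n` there is a labelled rank structure
in which that point has rank `n`. -/
theorem exists_labelledRank {X : Type*} [TopologicalSpace X] [T2Space X] [FirstCountableTopology X]
    (E : ℕ → Set X) (hE : ∀ n, ∀ x ∈ E (n + 1), AccPt x (𝓟 (E n))) (n : ℕ) :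
    ∀ x ∈ E n, ∀ U, IsOpen U → x ∈ U → ∃ T G : ℕ → Set X, LabelledRank T G ∧
      T 0 ⊆ U ∧ (∀ i, G i ⊆ U) ∧ x ∈ T n ∧ ∀ i, x ∉ G i := by
  induction n with
  | zero =>
    intro x _ U _ hxU
    -- Only level `0` is non-empty, so the limit condition is vacuous.
    refine ⟨fun m => {y | m = 0 ∧ y = x}, fun _ => ∅, ⟨?_, ?_, ?_, ?_⟩, ?_, ?_, ?_, ?_⟩
    · rintro a b hab y ⟨rfl, rfl⟩
      exact ⟨by lia, rfl⟩
    · simp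
    · simp
    · simp
    · rintro y ⟨-, rfl⟩
      exact hxU
    · simp
    · simp
    · simp
  | succ n ih =>
    intro x hx U hU hxU
    obtain ⟨b, hb⟩ := (𝓝 x).exists_antitone_basis
    have hacc := accPt_iff_nhds.1 (hE n x hx)
    choose y hyb hyx using fun a => hacc (b a ∩ U) (inter_mem (hb.mem a) (hU.mem_nhds hxU))
    have hyt : Tendsto y atTop (𝓝 x) := hb.tendsto fun a => (hyb a).1.1
    obtain ⟨φ, hφ, O, hO, hyO, hxO, hdisj⟩ := exists_subseq_disjoint_open hyt hyx
    choose T G hTG hTU hGU hyT hyG using fun a => ih (y (φ a)) (hyb _).2 (O a ∩ U) ((hO a).inter hU)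
      ⟨hyO a, (hyb _).1.2⟩
    have hdisj' : ∀ {a c z}, z ∈ O a → z ∈ O c → a = c := fun {a c z} h h' => by
      by_contra hac
      exact disjoint_left.1 (hdisj hac) h h'
    have hTO : ∀ {a m z}, z ∈ T a m → z ∈ O a ∩ U := fun {a m z} h =>
      hTU a ((hTG a).antitone (Nat.zero_le m) h)
    have hG' : ∀ a i z, z ∈ O a → (z ∈ (⋃ c, G c i) ∪ ⋃ c ∈ {c : ℕ | c.unpair.1 = i}, O c ∩ U ↔
        z ∈ G a i ∨ (a.unpair.1 = i ∧ z ∈ U)) := by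
      intro a i z hz
      simp only [mem_union, mem_iUnion, mem_ofPred_eq, exists_prop]
      constructor
      · rintro (⟨c, hc⟩ | ⟨c, hc, hzc⟩)
        · obtain rfl := hdisj' hz (hGU c i hc).1
          exact Or.inl hc
        · obtain rfl := hdisj' hz hzc.1
          exact Or.inr ⟨hc, hzc.2⟩
      · rintro (h | ⟨h, hzU⟩)
        exacts [Or.inl ⟨a, h⟩, Or.inr ⟨a, h, hz, hzU⟩]
    -- The structures around the points `y (φ a)` are united, `x` is added on top, and all of `O a ∩
    -- U` receives the extra label `a.unpair.1`. Every label is thus used for infinitely many `a`,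
    -- and inside one `O a` the extra label is common to all points, so the old limit condition
    -- persists.
    refine ⟨fun m => {z | m ≤ n + 1 ∧ z = x} ∪ ⋃ a, T a m,
      fun i => (⋃ c, G c i) ∪ ⋃ c ∈ {c : ℕ | c.unpair.1 = i}, O c ∩ U, ⟨?_, ?_, ?_, ?_⟩, ?_, ?_, ?_, ?_⟩
    · intro m m' hmm
      refine union_subset_union ?_ (iUnion_mono fun a => (hTG a).antitone hmm)
      rintro z ⟨h, rfl⟩
      exact ⟨by lia, rfl⟩
    · exact ((countable_singleton x).mono fun z hz => hz.2).union
        (countable_iUnion fun a => (hTG a).countable)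
    · exact fun i => (isOpen_iUnion fun a => (hTG a).isOpen i).union
        (isOpen_biUnion fun a _ => (hO a).inter hU)
    · rintro m i z (⟨hm, rfl⟩ | hz)
      · rw [mem_closure_iff_nhds]
        intro s hs
        obtain ⟨N, hN⟩ := eventually_atTop.1 ((hyt.comp hφ.tendsto_atTop).eventually_mem hs)
        have hNa : N ≤ Nat.pair i N := Nat.right_le_pair i N
        refine ⟨y (φ (Nat.pair i N)), hN _ hNa, Or.inr (mem_iUnion.2 ⟨Nat.pair i N,
          (hTG _).antitone (by lia) (hyT _)⟩), ?_, ?_⟩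
        · exact (hG' _ _ _ (hyO _)).2 (Or.inr ⟨by simp, (hyb _).1.2⟩)
        · intro j hj h
          rcases (hG' _ _ _ (hyO _)).1 h with h | h
          · exact absurd h (hyG _ _)
          · exact absurd (by simpa using h.1.symm) hj
      · obtain ⟨a, ha⟩ := mem_iUnion.1 hz
        refine closure_mono ?_ ((hTG a).mem_closure m i z ha)
        rintro w ⟨hwT, hwG, hw⟩
        refine ⟨Or.inr (mem_iUnion.2 ⟨a, hwT⟩), (hG' a _ _ (hTO hwT).1).2 (Or.inl hwG), ?_⟩
        intro j hj h
        refine (hG' a _ _ (hTO ha).1).2 (((hG' a _ _ (hTO hwT).1).1 h).imp (hw j hj) ?_)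
        exact fun h => ⟨h.1, (hTO ha).2⟩
    · rintro z (⟨-, rfl⟩ | hz)
      · exact hxU
      · obtain ⟨a, ha⟩ := mem_iUnion.1 hz
        exact (hTO ha).2
    · rintro i z (hz | hz)
      · obtain ⟨a, ha⟩ := mem_iUnion.1 hz
        exact (hGU a i ha).2
      · obtain ⟨a, -, ha⟩ := mem_iUnion₂.1 hz
        exact ha.2
    · exact Or.inl ⟨le_rfl, rfl⟩
    · rintro i (hz | hz)
      · obtain ⟨a, ha⟩ := mem_iUnion.1 hz
        exact hxO a (hGU a i ha).1
      · obtain ⟨a, -, ha⟩ := mem_iUnion₂.1 hz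
        exact hxO a ha.1

/-! ### Open sets indexed by the continuum near `p` -/

/-- There is a family of `𝔠` many sequences of natural numbers, any two of which are eventually
different. -/
theorem exists_eventually_different {ι : Type*} (hι : Cardinal.mk ι = Cardinal.continuum) :
    ∃ a : ι → ℕ → ℕ, ∀ α β, α ≠ β → ∃ N, ∀ n ≥ N, a α n ≠ a β n := by
  have h : Cardinal.lift.{0} (Cardinal.mk ι) = Cardinal.lift (Cardinal.mk (ℕ → Bool)) := by
    simp [hι]
  obtain ⟨e⟩ := Cardinal.lift_mk_eq'.1 h
  -- Distinct binary sequences have distinct initial segments from some length on.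
  refine ⟨fun α n => Encodable.encode (List.ofFn fun i : Fin n => e α i), fun α β hαβ => ?_⟩
  obtain ⟨i, hi⟩ := Function.ne_iff.1 (e.injective.ne hαβ)
  refine ⟨i + 1, fun n hn hcon => hi ?_⟩
  exact congrFun (List.ofFn_injective (Encodable.encode_injective hcon)) ⟨i, by lia⟩

/-- At `∞` there may be no countable neighbourhood base. If the traces of the levels on `Ω` have
compact intersection, points chosen outside a compact neighbourhood of it eventually leave every
compact set; otherwise the intersection contains a sequence without convergent subsequence in it. -/
theorem exists_seq_tendsto_of_mem_cbLevelInfty {Ω : Type*} [TopologicalSpace Ω]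
    [LocallyCompactSpace Ω] [TopologicalSpace.MetrizableSpace Ω] {p : OnePoint Ω}
    (hp : p ∈ cbLevelInfty (OnePoint Ω)) :
    ∃ x : ℕ → Ω, (∀ n, (x n : OnePoint Ω) ∈ cbLevel (OnePoint Ω) n) ∧
      (∀ n, (x n : OnePoint Ω) ≠ p) ∧ Tendsto (fun n => (x n : OnePoint Ω)) atTop (𝓝 p) := by
  have hanti : Antitone (cbLevel (OnePoint Ω)) := antitone_nat_of_succ_le fun n => by
    rw [cbLevel_succ]; exact relDerivedSet_subset
  have hclosed : ∀ n, IsClosed (cbLevel (OnePoint Ω) n) := fun n =>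
    CantorBendixson.isClosed_iteratedDerivedSet isClosed_univ _
  have hacc : ∀ n, AccPt p (𝓟 (cbLevel (OnePoint Ω) n)) := fun n => by
    have := mem_iInter.1 hp (n + 1)
    rw [cbLevel_succ] at this
    exact this.1
  induction p using OnePoint.rec with
  | coe q =>
    obtain ⟨b, hb⟩ := (𝓝 q).exists_antitone_basis
    have : ∀ n, ∃ x : Ω, (x : OnePoint Ω) ∈ cbLevel (OnePoint Ω) n ∧ x ≠ q ∧ x ∈ b n := fun n => by
      have hbn : ((↑) : Ω → OnePoint Ω) '' b n ∈ 𝓝 (q : OnePoint Ω) := by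
        rw [OnePoint.nhds_coe_eq]; exact image_mem_map (hb.mem n)
      obtain ⟨_, ⟨⟨x, hx, rfl⟩, hxl⟩, hxq⟩ := accPt_iff_nhds.1 (hacc n) _ hbn
      exact ⟨x, hxl, fun h => hxq (by rw [h]), hx⟩
    choose x hxl hxq hxb using this
    refine ⟨x, hxl, fun n h => hxq n (OnePoint.coe_injective h), ?_⟩
    rw [OnePoint.nhds_coe_eq]
    exact tendsto_map.comp (hb.tendsto hxb)
  | infty =>
    let E : ℕ → Set Ω := fun n => (↑) ⁻¹' cbLevel (OnePoint Ω) n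
    have hE : ∀ n, IsClosed (E n) := fun n => (hclosed n).preimage OnePoint.continuous_coe
    have hEanti : Antitone E := fun m n h => preimage_mono (hanti h)
    have hEnc : ∀ n K, IsCompact K → ∃ x ∈ E n, x ∉ K := fun n K hK => by
      obtain ⟨y, ⟨hyK, hyE⟩, hy⟩ := accPt_iff_nhds.1 (hacc n) _
        ((OnePoint.isOpen_compl_image_coe.2 ⟨hK.isClosed, hK⟩).mem_nhds
          OnePoint.infty_notMem_image_coe)
      induction y using OnePoint.rec with
      | infty => exact absurd rfl hy
      | coe x => exact ⟨x, hyE, fun hx => hyK ⟨x, hx, rfl⟩⟩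
    suffices h : ∃ x : ℕ → Ω, (∀ n, x n ∈ E n) ∧ Tendsto x atTop (cocompact Ω) by
      obtain ⟨x, hx, hxt⟩ := h
      refine ⟨x, hx, fun n => OnePoint.coe_ne_infty _, OnePoint.tendsto_coe_infty.comp ?_⟩
      rwa [coclosedCompact_eq_cocompact]
    by_cases hc : IsCompact (⋂ n, E n)
    · obtain ⟨K, hK, hEK⟩ := exists_compact_superset hc
      choose x hxE hxK using fun n => hEnc n K hK
      refine ⟨x, hxE, (hasBasis_cocompact.tendsto_right_iff).2 fun C hC => ?_⟩
      obtain ⟨n, hn⟩ := (hC.diff isOpen_interior).elim_directed_family_closed E hE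
        (by
          rw [← disjoint_iff_inter_eq_empty, disjoint_left]
          exact fun z hz hz' => hz.2 (hEK hz')) hEanti.directed_ge
      refine eventually_atTop.2 ⟨n, fun k hk hkC => ?_⟩
      exact hn.subset ⟨⟨hkC, fun h => hxK k (interior_subset h)⟩, hEanti hk (hxE k)⟩
    · rw [isCompact_iff_isSeqCompact, IsSeqCompact] at hc
      push Not at hc
      obtain ⟨x, hxE, hx⟩ := hc
      refine ⟨x, fun n => mem_iInter.1 (hxE n) n,
        (hasBasis_cocompact.tendsto_right_iff).2 fun C hC => ?_⟩
      by_contra hcon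
      have hfr : ∃ᶠ n in atTop, x n ∈ C := by simpa [Filter.Frequently] using hcon
      obtain ⟨a, -, φ, hφ, hlim⟩ := hC.isSeqCompact.subseq_of_frequently_in hfr
      refine hx a ?_ φ hφ hlim
      exact (isClosed_iInter hE).mem_of_tendsto hlim (Eventually.of_forall fun n => hxE _)

/-- The open sets and the decreasing sequence of sets to which
`exists_pseudoFinite_ultrafilters` applies. -/
theorem exists_labelled_family {Ω ι : Type*} [TopologicalSpace Ω]
    [LocallyCompactSpace Ω] [TopologicalSpace.MetrizableSpace Ω] {p : OnePoint Ω}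
    (hp : p ∈ cbLevelInfty (OnePoint Ω)) (hι : Cardinal.mk ι = Cardinal.continuum) :
    ∃ (T : ℕ → Set Ω) (G : ι → Set Ω), Antitone T ∧ (T 0).Countable ∧ (∀ α, IsOpen (G α)) ∧
      (∀ (F : Finset ι) (m : ℕ), ∀ s ∈ comap ((↑) : Ω → OnePoint Ω) (𝓝 p),
        (s ∩ (T m \ ⋃ β ∈ F, G β)).Nonempty) ∧
      ∀ (F : Finset ι) (α : ι) (m : ℕ), α ∉ F → ∃ M,
        T M \ ⋃ β ∈ F, G β ⊆ closure ((T m \ ⋃ β ∈ F, G β) ∩ G α) := by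
  have hanti : Antitone (cbLevel (OnePoint Ω)) := antitone_nat_of_succ_le fun n => by
    rw [cbLevel_succ]; exact relDerivedSet_subset
  obtain ⟨x, hxl, hxp, hxt⟩ := exists_seq_tendsto_of_mem_cbLevelInfty hp
  obtain ⟨φ, hφ, U, hU, hxU, -, hdisj⟩ := exists_subseq_disjoint_open hxt hxp
  obtain ⟨a, ha⟩ := exists_eventually_different hι
  let E : ℕ → Set Ω := fun n => (↑) ⁻¹' cbLevel (OnePoint Ω) n
  have hE : ∀ n, ∀ x ∈ E (n + 1), AccPt x (𝓟 (E n)) := by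
    intro n y hy
    have h : AccPt (y : OnePoint Ω) (𝓟 (cbLevel (OnePoint Ω) n)) := by
      have hy : (y : OnePoint Ω) ∈ cbLevel (OnePoint Ω) (n + 1) := hy
      rw [cbLevel_succ] at hy
      exact hy.1
    rw [accPt_iff_nhds] at h ⊢
    intro s hs
    have hs' : ((↑) : Ω → OnePoint Ω) '' s ∈ 𝓝 (y : OnePoint Ω) := by
      rw [OnePoint.nhds_coe_eq]; exact image_mem_map hs
    obtain ⟨_, ⟨⟨z, hz, rfl⟩, hzl⟩, hzy⟩ := h _ hs'
    exact ⟨z, ⟨hz, hzl⟩, fun h => hzy (by rw [h])⟩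
  choose T G hTG hTU hGU hxT hxG using fun n => exists_labelledRank E hE n (x (φ n))
    (hanti (hφ.id_le n) (hxl _)) (((↑) : Ω → OnePoint Ω) ⁻¹' U n)
    ((hU n).preimage OnePoint.continuous_coe) (hxU n)
  have hdisj' : ∀ {k n} {z : Ω}, (z : OnePoint Ω) ∈ U k → (z : OnePoint Ω) ∈ U n → k = n :=
    fun {k n z} h h' => by
      by_contra hkn
      exact disjoint_left.1 (hdisj hkn) h h'
  have hTU' : ∀ {n m z}, z ∈ T n m → (z : OnePoint Ω) ∈ U n := fun {n m z} h =>
    hTU n ((hTG n).antitone (Nat.zero_le m) h)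
  -- Only `n ≥ m` enters level `m`, so that large `M` forces large `n`, where the labels `a α n` and
  -- `a β n` differ.
  refine ⟨fun m => ⋃ n ∈ Ici m, T n m, fun α => ⋃ n, G n (a α n), ?_, ?_, ?_, ?_, ?_⟩
  · intro m m' h z hz
    simp only [mem_iUnion, mem_Ici] at hz ⊢
    obtain ⟨n, hn, hz⟩ := hz
    exact ⟨n, h.trans hn, (hTG n).antitone h hz⟩
  · exact (countable_iUnion fun n => (hTG n).countable).mono
      (iUnion₂_subset fun n _ => subset_iUnion (fun n => T n 0) n)
  · exact fun α => isOpen_iUnion fun n => (hTG n).isOpen _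
  · rintro F m s ⟨t, ht, hts⟩
    obtain ⟨N, hN⟩ := eventually_atTop.1 ((hxt.comp hφ.tendsto_atTop).eventually_mem ht)
    let n := max m N
    refine ⟨x (φ n), hts (hN n (le_max_right _ _)), ?_, ?_⟩
    · exact mem_iUnion₂.2 ⟨n, mem_Ici.2 (le_max_left m N), (hTG n).antitone (le_max_left _ _) (hxT n)⟩
    · simp only [mem_iUnion, not_exists]
      intro β _ k hk
      obtain rfl := hdisj' (hxU n) (hGU k _ hk)
      exact hxG _ _ hk
  · intro F α m hα
    have : ∃ M, m < M ∧ ∀ n ≥ M, ∀ β ∈ F, a α n ≠ a β n := by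
      have : ∀ᶠ n in atTop, ∀ β ∈ F, a α n ≠ a β n := by
        rw [Finset.eventually_all]
        exact fun β hβ => eventually_atTop.2 (ha α β fun h => hα (h ▸ hβ))
      obtain ⟨M, hM⟩ := eventually_atTop.1 this
      exact ⟨max M (m + 1), by lia, fun n hn => hM n (by lia)⟩
    obtain ⟨M, hmM, hM⟩ := this
    refine ⟨M, ?_⟩
    rintro y ⟨hyT, hyG⟩
    simp only [mem_iUnion, mem_Ici] at hyT
    obtain ⟨n, hn, hyT⟩ := hyT
    refine closure_mono ?_ ((hTG n).mem_closure m (a α n) y ((hTG n).antitone hmM hyT))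
    rintro z ⟨hzT, hzG, hz⟩
    refine ⟨⟨mem_iUnion₂.2 ⟨n, by simp only [mem_Ici]; lia, hzT⟩, fun hzF => hyG ?_⟩,
      mem_iUnion.2 ⟨n, hzG⟩⟩
    simp only [mem_iUnion] at hzF ⊢
    obtain ⟨β, hβ, k, hk⟩ := hzF
    obtain rfl := hdisj' (hTU' hzT) (hGU k _ hk)
    exact ⟨β, hβ, n, hz _ (hM n hn β hβ).symm hk⟩

/-! ### Zero sets, z-filters and ideals from ultrafilters -/

variable {𝕜 : Type*} [RCLike 𝕜] {Ω : Type*} [TopologicalSpace Ω]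

theorem isClosed_of_mem_zeroSets {Z : Set Ω} (hZ : Z ∈ zeroSets 𝕜 Ω) : IsClosed Z := by
  obtain ⟨f, rfl⟩ := hZ
  exact isClosed_singleton.preimage f.continuous

variable (𝕜) in
/-- In a metrizable space every closed set is the zero set of a bounded continuous function. -/
theorem exists_bounded_zeroSet_eq [TopologicalSpace.MetrizableSpace Ω] {Z : Set Ω}
    (hZ : IsClosed Z) : ∃ g : C(Ω, 𝕜), {x | g x = 0} = Z ∧ ∀ x, ‖g x‖ ≤ 1 := by
  let := TopologicalSpace.metrizableSpaceMetric Ω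
  -- `Metric.infDist` to the empty set takes the default value `0`, hence the separate case.
  rcases Z.eq_empty_or_nonempty with rfl | hne
  · exact ⟨1, by simp, by simp⟩
  · refine ⟨⟨fun x => ((min 1 (Metric.infDist x Z) : ℝ) : 𝕜), RCLike.continuous_ofReal.comp
      (continuous_const.min (Metric.continuous_infDist_pt Z))⟩, ?_, ?_⟩
    · ext x
      simp only [ContinuousMap.coe_mk, mem_ofPred_eq, RCLike.ofReal_eq_zero]
      rw [hZ.mem_iff_infDist_zero hne]
      have h0 : 0 ≤ Metric.infDist x Z := Metric.infDist_nonneg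
      constructor
      · intro h
        rcases min_choice 1 (Metric.infDist x Z) with h' | h' <;> linarith
      · intro h
        simp [h]
    · intro x
      simp only [ContinuousMap.coe_mk, RCLike.norm_ofReal]
      rw [abs_of_nonneg (le_min zero_le_one Metric.infDist_nonneg)]
      exact min_le_left _ _

variable (𝕜) in
/-- The zero sets that belong to an ultrafilter form a `z`-filter. -/
def zFilterOf (u : Ultrafilter Ω) : ZFilter 𝕜 Ω where
  sets := {Z | Z ∈ zeroSets 𝕜 Ω ∧ Z ∈ u}
  subset_zeroSets := fun _ h => h.1
  nonempty := ⟨univ, ⟨0, by simp⟩, univ_mem⟩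
  proper := fun h => by
    have : (∅ : Set Ω) ∈ zeroSets 𝕜 Ω := ⟨1, by simp⟩
    rw [← h] at this
    exact u.empty_notMem this.2
  inter_mem := by
    rintro _ ⟨⟨f, rfl⟩, hf⟩ _ ⟨⟨g, rfl⟩, hg⟩
    refine ⟨⟨⟨fun x => ((‖f x‖ + ‖g x‖ : ℝ) : 𝕜), by fun_prop⟩, ?_⟩, inter_mem hf hg⟩
    ext x
    simp only [mem_inter_iff, mem_ofPred_eq, ContinuousMap.coe_mk, RCLike.ofReal_eq_zero]
    rw [add_eq_zero_iff_of_nonneg (norm_nonneg _) (norm_nonneg _), norm_eq_zero, norm_eq_zero]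
  mem_of_superset := fun _ h₁ _ h₂ h => ⟨h₂, mem_of_superset h₁.2 h⟩

theorem zFilterOf_isPrime (u : Ultrafilter Ω) : (zFilterOf 𝕜 u).IsPrime := by
  rintro Z₁ hZ₁ Z₂ hZ₂ h₁ h₂ ⟨-, h⟩
  rcases Ultrafilter.union_mem_iff.1 h with h | h
  exacts [h₁ ⟨hZ₁, h⟩, h₂ ⟨hZ₂, h⟩]

theorem mem_c0Ideal_zFilterOf {u : Ultrafilter Ω} {f : C₀(Ω, 𝕜)} :
    f ∈ (zFilterOf 𝕜 u).c0Ideal ↔ {x | f x = 0} ∈ u :=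
  ⟨fun h => h.2, fun h => ⟨zeroSet_mem f, h⟩⟩

theorem isIdeal_c0Ideal (F : ZFilter 𝕜 Ω) : IsIdeal F.c0Ideal := fun f g hg =>
  F.mem_of_superset _ hg _ (zeroSet_mem (f * g)) fun x (hx : g x = 0) => by simp [hx]

theorem isZIdeal_c0Ideal (F : ZFilter 𝕜 Ω) : IsZIdeal F.c0Ideal :=
  ⟨isIdeal_c0Ideal F, fun _ hf g h => F.mem_of_superset _ hf _ (zeroSet_mem g) h⟩

theorem isPrimeIdeal_c0Ideal_zFilterOf {u : Ultrafilter Ω}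
    (hu : (zFilterOf 𝕜 u).c0Ideal ≠ ⊤) : IsPrimeIdeal (zFilterOf 𝕜 u).c0Ideal := by
  refine ⟨isIdeal_c0Ideal _, hu, fun f g h => ?_⟩
  simp only [mem_c0Ideal_zFilterOf] at h ⊢
  rw [← Ultrafilter.union_mem_iff]
  convert h using 2
  ext x
  simp

section LocallyCompact

variable [LocallyCompactSpace Ω] [T2Space Ω]

variable (𝕜) in
/-- Bump functions in `C₀(Ω, 𝕜)` separate compact sets from disjoint closed sets. -/
theorem exists_c0_one_zero {K Z : Set Ω} (hK : IsCompact K) (hZ : IsClosed Z)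
    (hd : Disjoint K Z) : ∃ f : C₀(Ω, 𝕜), (∀ x ∈ K, f x = 1) ∧ (∀ x ∈ Z, f x = 0) ∧
      (∃ C, IsCompact C ∧ ∀ x ∉ C, f x = 0) ∧ ∀ x, ∃ r ∈ Icc (0 : ℝ) 1, f x = (r : 𝕜) := by
  obtain ⟨f, h1, h0, hc, hf⟩ := exists_continuous_one_zero_of_isCompact hK hZ hd
  have hc' : HasCompactSupport fun x => ((f x : ℝ) : 𝕜) :=
    hc.comp_left (g := fun r : ℝ => (r : 𝕜)) (by simp)
  refine ⟨⟨⟨fun x => ((f x : ℝ) : 𝕜), by fun_prop⟩, hc'.is_zero_at_infty⟩, ?_, ?_, ?_, ?_⟩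
  · intro x hx
    have : f x = 1 := h1 hx
    change ((f x : ℝ) : 𝕜) = 1
    simp [this]
  · intro x hx
    have : f x = 0 := h0 hx
    change ((f x : ℝ) : 𝕜) = 0
    simp [this]
  · exact ⟨_, hc', fun x hx => image_eq_zero_of_notMem_tsupport hx⟩
  · exact fun x => ⟨f x, hf x, rfl⟩

variable (𝕜) in
/-- Some function in `C₀(Ω, 𝕜)` vanishes nowhere on a given countable set. -/
theorem exists_c0_ne_zero_on_countable {S : Set Ω} (hS : S.Countable) :
    ∃ f : C₀(Ω, 𝕜), ∀ x ∈ S, f x ≠ 0 := by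
  rcases S.eq_empty_or_nonempty with rfl | hne
  · exact ⟨0, by simp⟩
  obtain ⟨t, rfl⟩ := hS.exists_eq_range hne
  have hbump : ∀ k, ∃ f : C₀(Ω, 𝕜), f (t k) = 1 ∧ ∀ x, ∃ r ∈ Icc (0 : ℝ) 1, f x = (r : 𝕜) :=
    fun k => by
      obtain ⟨f, h1, -, -, hf⟩ := exists_c0_one_zero 𝕜 (isCompact_singleton (x := t k))
        isClosed_empty (disjoint_empty _)
      exact ⟨f, h1 _ rfl, hf⟩
  choose f hf1 hf using hbump
  choose r hr hfr using hf
  have hnorm : ∀ k, ‖(((1 / 2 : ℝ) ^ k : ℝ) : 𝕜) • f k‖ ≤ (1 / 2) ^ k := by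
    intro k
    rw [norm_smul, RCLike.norm_ofReal, abs_of_nonneg (by positivity)]
    refine mul_le_of_le_one_right (by positivity) ?_
    rw [← ZeroAtInftyContinuousMap.norm_toBCF_eq_norm, BoundedContinuousFunction.norm_le zero_le_one]
    intro x
    change ‖f k x‖ ≤ 1
    rw [hfr, RCLike.norm_ofReal, abs_of_nonneg (hr k x).1]
    exact (hr k x).2
  have hsum : Summable fun k => (((1 / 2 : ℝ) ^ k : ℝ) : 𝕜) • f k :=
    Summable.of_norm_bounded summable_geometric_two hnorm
  refine ⟨∑' k, (((1 / 2 : ℝ) ^ k : ℝ) : 𝕜) • f k, ?_⟩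
  rintro _ ⟨k, rfl⟩ h0
  -- Evaluation at `t k` turns the sum into a series of non-negative reals; if it vanished, so would
  -- its `k`-th term `(1 / 2) ^ k`.
  let ev : C₀(Ω, 𝕜) →+ 𝕜 :=
    { toFun := fun g => g (t k), map_zero' := rfl, map_add' := fun _ _ => rfl }
  have hev : Continuous ev := by
    refine AddMonoidHomClass.continuous_of_bound ev 1 fun g => ?_
    rw [one_mul, ← ZeroAtInftyContinuousMap.norm_toBCF_eq_norm]
    exact BoundedContinuousFunction.norm_coe_le_norm g.toBCF (t k)
  have h := hsum.hasSum.map ev hev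
  have hterm : (⇑ev ∘ fun k => (((1 / 2 : ℝ) ^ k : ℝ) : 𝕜) • f k) =
      fun j => (((1 / 2 : ℝ) ^ j * r j (t k) : ℝ) : 𝕜) := by
    funext j
    change (((1 / 2 : ℝ) ^ j : ℝ) : 𝕜) • f j (t k) = _
    rw [hfr, smul_eq_mul, RCLike.ofReal_mul]
  rw [hterm, show ev (∑' k, (((1 / 2 : ℝ) ^ k : ℝ) : 𝕜) • f k) = ((0 : ℝ) : 𝕜) by
    rw [RCLike.ofReal_zero]; exact h0, RCLike.hasSum_ofReal] at h
  have hz := (hasSum_zero_iff_of_nonneg fun j => mul_nonneg (by positivity) (hr j (t k)).1).1 h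
  have hk := congrFun hz k
  have hrk : r k (t k) = 1 := by
    have := hfr k (t k)
    rw [hf1 k] at this
    exact_mod_cast this.symm
  simp [hrk] at hk

/-- Functions in `C₀(Ω, 𝕜)` separate the points of `Ω` from neighbourhoods of other points of the
one-point compactification. -/
theorem exists_c0_ne_zero_of_ne {p : OnePoint Ω} {q : Ω} (hq : (q : OnePoint Ω) ≠ p) :
    ∃ f : C₀(Ω, 𝕜), f q ≠ 0 ∧ {x | f x = 0} ∈ comap ((↑) : Ω → OnePoint Ω) (𝓝 p) := by
  induction p using OnePoint.rec with
  | infty =>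
    obtain ⟨f, h1, -, ⟨C, hC, hfC⟩, -⟩ := exists_c0_one_zero 𝕜 (isCompact_singleton (x := q))
      isClosed_empty (disjoint_empty _)
    refine ⟨f, by simp [h1], ?_⟩
    rw [OnePoint.comap_coe_nhds_infty, coclosedCompact_eq_cocompact]
    exact mem_of_superset hC.compl_mem_cocompact hfC
  | coe p =>
    obtain ⟨A, B, hA, hB, hqA, hpB, hAB⟩ := t2_separation fun h => hq (congrArg _ h)
    obtain ⟨f, h1, h0, -, -⟩ := exists_c0_one_zero 𝕜 (isCompact_singleton (x := q))
      hA.isClosed_compl (by simpa using hqA)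
    refine ⟨f, by simp [h1], ?_⟩
    rw [OnePoint.comap_coe_nhds]
    exact mem_of_superset (hB.mem_nhds hpB) fun x hx => h0 x fun hxA => disjoint_left.1 hAB hxA hx

/-- Functions vanishing near `p` belong to the ideal and exclude every other common zero. If `p`
lies in `Ω`, it is a limit of the ultrafilter, hence in each closed member. -/
theorem idealSupportedAt_c0Ideal_zFilterOf {u : Ultrafilter Ω} {p : OnePoint Ω}
    (hu : ↑u ≤ comap ((↑) : Ω → OnePoint Ω) (𝓝 p)) :
    IdealSupportedAt (zFilterOf 𝕜 u).c0Ideal p := by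
  have key : ∀ q : Ω, (∀ f ∈ (zFilterOf 𝕜 u).c0Ideal, f q = 0) → (q : OnePoint Ω) = p := by
    intro q hq
    by_contra hne
    obtain ⟨f, hfq, hf⟩ := exists_c0_ne_zero_of_ne (𝕜 := 𝕜) hne
    exact hfq (hq f (mem_c0Ideal_zFilterOf.2 (hu hf)))
  induction p using OnePoint.rec with
  | infty => exact fun ⟨q, hq⟩ => OnePoint.coe_ne_infty q (key q hq)
  | coe p =>
    rw [OnePoint.comap_coe_nhds] at hu
    refine fun q => ⟨fun h => OnePoint.coe_injective (key q h), ?_⟩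
    rintro rfl f hf
    exact (isClosed_singleton.preimage (map_continuous f)).closure_subset
      (mem_closure_iff_ultrafilter.2 ⟨u, mem_c0Ideal_zFilterOf.1 hf, hu⟩)

theorem supportedAt_zFilterOf {u : Ultrafilter Ω} {p : OnePoint Ω}
    (hu : ↑u ≤ comap ((↑) : Ω → OnePoint Ω) (𝓝 p)) : (zFilterOf 𝕜 u).SupportedAt p := by
  induction p using OnePoint.rec with
  | infty =>
    rintro ⟨q, hq⟩
    refine idealSupportedAt_c0Ideal_zFilterOf (𝕜 := 𝕜) hu ⟨q, fun f hf => ?_⟩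
    exact hq _ hf
  | coe p =>
    rw [OnePoint.comap_coe_nhds] at hu
    intro Z hZ
    exact (isClosed_of_mem_zeroSets hZ.1).closure_subset
      (mem_closure_iff_ultrafilter.2 ⟨u, hZ.2, hu⟩)

end LocallyCompact

/-! ### Cardinality and non-redundancy -/

/-- A quotient of `C₀(Ω, 𝕜)` by a proper subspace containing all functions that vanish on some
countable set has the cardinality of the continuum. -/
theorem mk_quotient_eq_continuum {I : Submodule 𝕜 C₀(Ω, 𝕜)} (hI : I ≠ ⊤) {S : Set Ω}
    (hS : S.Countable) (h : ∀ f : C₀(Ω, 𝕜), (∀ x ∈ S, f x = 0) → f ∈ I) :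
    Cardinal.mk (C₀(Ω, 𝕜) ⧸ I) = Cardinal.continuum := by
  apply le_antisymm
  · let e : (C₀(Ω, 𝕜) ⧸ I) → S → ℝ × ℝ := fun a x =>
      (RCLike.re (Quotient.out a x), RCLike.im (Quotient.out a x))
    have he : Function.Injective e := by
      intro a b hab
      rw [← Quotient.out_eq a, ← Quotient.out_eq b]
      refine (Submodule.Quotient.eq I).2 (h _ fun x hx => ?_)
      have hx := congrFun hab ⟨x, hx⟩
      rw [ZeroAtInftyContinuousMap.sub_apply, sub_eq_zero]
      exact RCLike.ext (congrArg Prod.fst hx) (congrArg Prod.snd hx)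
    have h2 := Cardinal.lift_mk_le_lift_mk_of_injective he
    have h3 : Cardinal.mk (S → ℝ × ℝ) ≤ Cardinal.continuum := by
      have hc : Cardinal.mk S ≤ Cardinal.aleph0 := Cardinal.mk_le_aleph0_iff.2 hS
      have h : Cardinal.mk (S → ℝ × ℝ) = Cardinal.continuum ^ Cardinal.mk S := by
        simp [Cardinal.mk_real]
      rw [h]
      exact (Cardinal.power_le_power_left Cardinal.continuum_ne_zero hc).trans_eq
        Cardinal.continuum_power_aleph0
    have h4 := h2.trans (Cardinal.lift_le.2 h3)
    simpa using h4
  · have : Nontrivial (C₀(Ω, 𝕜) ⧸ I) := Submodule.Quotient.nontrivial_iff.2 hI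
    exact continuum_le_cardinal_of_module 𝕜 (C₀(Ω, 𝕜) ⧸ I)

theorem nonRedundant_of_forall_exists {ι X : Type*} {P : ι → Set X}
    (h : ∀ α, ∃ x, x ∉ P α ∧ ∀ β ≠ α, x ∈ P β) : NonRedundant P := by
  intro T hT hcon
  obtain ⟨α, hα⟩ := (ne_univ_iff_exists_notMem T).1 hT
  obtain ⟨x, hx, hxP⟩ := h α
  have : x ∈ ⋂ i ∈ T, P i := mem_iInter₂.2 fun β hβ => hxP β fun h => hα (h ▸ hβ)
  rw [hcon] at this
  exact hx (mem_iInter.1 this α)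

end PrimeZ

/-! ### The main theorem -/

theorem theorem3p7 {𝕜 : Type*} [RCLike 𝕜]
    {Ω : Type*} [TopologicalSpace Ω] [LocallyCompactSpace Ω] [TopologicalSpace.MetrizableSpace Ω]
    (p : OnePoint Ω) (hp : p ∈ PrimeZ.cbLevelInfty (OnePoint Ω))
    {ι : Type*} (hι : Cardinal.mk ι = Cardinal.continuum) :
    ∃ P : ι → PrimeZ.ZFilter 𝕜 Ω,
      (∀ α, (P α).IsPrime) ∧
      PrimeZ.PseudoFinite (fun α => (P α).sets) ∧
      PrimeZ.NonRedundant (fun α => (P α).sets) ∧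
      (∀ α, (P α).SupportedAt p) ∧
      (∀ α, PrimeZ.IsPrimeIdeal (P α).c0Ideal ∧ PrimeZ.IsZIdeal (P α).c0Ideal) ∧
      PrimeZ.PseudoFinite (fun α => ((P α).c0Ideal : Set C₀(Ω, 𝕜))) ∧
      PrimeZ.NonRedundant (fun α => ((P α).c0Ideal : Set C₀(Ω, 𝕜))) ∧
      (∀ α, PrimeZ.IdealSupportedAt (P α).c0Ideal p) ∧
      Cardinal.mk (C₀(Ω, 𝕜) ⧸ ⨅ α, (P α).c0Ideal) = Cardinal.continuum := by
  open PrimeZ in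
  obtain ⟨T, G, hT, hTc, hG, hne, hcl⟩ := exists_labelled_family hp hι
  have hN : ∀ s ∈ comap ((↑) : Ω → OnePoint Ω) (𝓝 p),
      ∃ U ∈ comap ((↑) : Ω → OnePoint Ω) (𝓝 p), IsOpen U ∧ U ⊆ s := by
    rintro s ⟨t, ht, hts⟩
    obtain ⟨V, hVt, hV, hpV⟩ := mem_nhds_iff.1 ht
    exact ⟨_, preimage_mem_comap (hV.mem_nhds hpV), hV.preimage OnePoint.continuous_coe,
      (preimage_mono hVt).trans hts⟩
  obtain ⟨u, huN, huT, huG, huG', hfin⟩ := exists_pseudoFinite_ultrafilters _ hN T hT G hne hcl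
  obtain ⟨h, hh⟩ := exists_c0_ne_zero_on_countable 𝕜 hTc
  have hnotMem : ∀ (α : ι) (f : C₀(Ω, 𝕜)), (∀ x ∈ T 0 ∩ G α, f x ≠ 0) →
      f ∉ (zFilterOf 𝕜 (u α)).c0Ideal := by
    intro α f hf hfα
    obtain ⟨x, hx, hxf⟩ := (u α).nonempty_of_mem
      (inter_mem (inter_mem (huT α 0) (huG α)) (mem_c0Ideal_zFilterOf.1 hfα))
    exact hf x hx hxf
  have htop : ∀ α, (zFilterOf 𝕜 (u α)).c0Ideal ≠ ⊤ := fun α htop =>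
    hnotMem α h (fun x hx => hh x hx.1) (htop ▸ Submodule.mem_top)
  have hcompl : ∀ α β, β ≠ α → (G α)ᶜ ∈ u β := fun α β hβ =>
    Ultrafilter.compl_mem_iff_notMem.2 (huG' α β hβ.symm)
  have hι' : Nonempty ι := by
    rw [← Cardinal.mk_ne_zero_iff, hι]
    exact Cardinal.continuum_ne_zero
  refine ⟨fun α => zFilterOf 𝕜 (u α), fun α => zFilterOf_isPrime _, ?_, ?_,
    fun α => supportedAt_zFilterOf (huN α),
    fun α => ⟨isPrimeIdeal_c0Ideal_zFilterOf (htop α), isZIdeal_c0Ideal _⟩, ?_, ?_,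
    fun α => idealSupportedAt_c0Ideal_zFilterOf (huN α), ?_⟩
  · intro Z hZ
    obtain ⟨α, hα⟩ := mem_iUnion.1 hZ
    exact (hfin Z (isClosed_of_mem_zeroSets hα.1) α hα.2).subset fun β hβ h => hβ ⟨hα.1, h⟩
  · refine nonRedundant_of_forall_exists fun α => ?_
    obtain ⟨g, hg, -⟩ := exists_bounded_zeroSet_eq 𝕜 (hG α).isClosed_compl
    refine ⟨(G α)ᶜ, fun h => Ultrafilter.compl_mem_iff_notMem.1 h.2 (huG α), fun β hβ =>
      ⟨⟨g, hg.symm⟩, hcompl α β hβ⟩⟩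
  · intro f hf
    obtain ⟨α, hα⟩ := mem_iUnion.1 hf
    exact (hfin _ (isClosed_of_mem_zeroSets (zeroSet_mem f)) α hα.2).subset
      fun β hβ h => hβ (mem_c0Ideal_zFilterOf.2 h)
  · refine nonRedundant_of_forall_exists fun α => ?_
    obtain ⟨g, hg, hg1⟩ := exists_bounded_zeroSet_eq 𝕜 (hG α).isClosed_compl
    have hg0 : ∀ x, g x = 0 ↔ x ∉ G α := fun x => Set.ext_iff.1 hg x
    -- The factor `h` forces decay at infinity without creating zeros on `T 0`, and `T 0 ∩ G α`
    -- belongs to `u α`.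
    let f : C₀(Ω, 𝕜) := ⟨⟨fun x => h x * g x, by fun_prop⟩, squeeze_zero_norm
      (fun x => (norm_mul_le _ _).trans (mul_le_of_le_one_right (norm_nonneg _) (hg1 x)))
      (by simpa using (zero_at_infty h).norm)⟩
    refine ⟨f, hnotMem α f fun x hx => mul_ne_zero (hh x hx.1) fun h0 => (hg0 x).1 h0 hx.2, ?_⟩
    intro β hβ
    refine mem_c0Ideal_zFilterOf.2 (mem_of_superset (hcompl α β hβ) fun x hx => ?_)
    exact mul_eq_zero_of_right _ ((hg0 x).2 hx)
  · refine mk_quotient_eq_continuum (fun htop' => ?_) hTc fun f hf => ?_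
    · exact htop hι'.some (top_le_iff.1 (htop' ▸ iInf_le _ _))
    · rw [Submodule.mem_iInf]
      exact fun α => mem_c0Ideal_zFilterOf.2 (mem_of_superset (huT α 0) hf)
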